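/- Let $Z$ be a measurable space, $D$ a probability distribution on $Z$ (the data distribution of the target task) and $L:\mathbb{R}^d\times Z\to[0,1]$ a loss which is measurable in $z$ and, for every $z$, twice differentiable in $\theta$, $\eta$-smooth ($\|\nabla L(\theta,z)-\nabla L(\theta',z)\|\le\eta\|\theta-\theta'\|$) and with $\rho$-Lipschitz Hessian ($\|\nabla^2L(\theta,z)-\nabla^2L(\theta',z)\|_2\le\rho\|\theta-\theta'\|$), where $\eta>0$, $\rho\ge0$. Fix an initialization $\theta_0\in\mathbb{R}^d$. For a sample $S=(z_1,\dots,z_n)$ drawn i.i.d. from $D$ put $R(\theta)=\mathbb{E}_{z\sim D}L(\theta,z)$, $\hat R_S(\theta)=\frac1n\sum_jL(\theta,z_j)$ and $$\hat\gamma^{\pm}=\frac1n\sum_{j=1}^n\|\nabla^2L(\theta_0,z_j)\|_2+\sqrt{\hat R_S(\theta_0)}\pm n^{-1/4}.$$ Let $A(S)$ be the output of SGD with $U=n$ steps $\theta_u=\theta_{u-1}-\frac cu\nabla L(\theta_{u-1},z_{j_u})$, $u=1,\dots,n$, started at $\theta_0$, where $0<c\le\min\{\frac1\eta,\frac1{4(2\eta\ln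 n)^2}\}$ and the indices $j_1,\dots,j_n$ are drawn uniformly from $\{1,\dots,n\}$, independently of $S$, either with replacement or without replacement. SGD is called $\varepsilon$-on-average stable if $\mathbb{E}_S\mathbb{E}_A[R(A(S))-\hat R_S(A(S))]\le\varepsilon$. Then SGD is $\varepsilon$-on-average stable with $$\varepsilon=O\Big(\big(1+\tfrac1{c\hat\gamma^-}\big)\,\hat R_S(\theta_0)^{\frac{c\hat\gamma^+}{1+c\hat\gamma^+}}\,n^{-\frac1{1+c\hat\gamma^+}}\Big)$$ with high probability over $S$ for all sufficiently large $n$. Precisely: there are numbers $N(\delta,r)$, depending only on $\delta\in(0,1)$ and $r\in[0,1]$, and a constant $C>0$, depending only on $\eta$ and $\rho$, such that for all $d,Z,D,L,\theta_0$ as above, all $\delta\in(0,1)$ and all $n\ge N(\delta,R(\theta_0))$, with probability at least $1-\delta$ over the sample $S\sim D^n$: if $R(\theta_0)>0$ then $\hat\gamma^->0$; and if $\hat\gamma^->0$, then for every admissible $c$ and for both sampling schemes SGD is $\varepsilon$-on-average stable with $$\varepsilon=C\,\big(1+\tfrac1{c\hat\gamma^-}\big)\,\hat R_S(\theta_0)^{\frac{c\hat\gamma^+}{1+c\hat\gamma^+}}\,n^{-\frac1{1+c\hat\gamma^+}}.$$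 -/

import Mathlib

open MeasureTheory

noncomputable section

/-- The parameter space `ℝ^d` with its Euclidean norm. -/
abbrev Param (d : ℕ) : Type := EuclideanSpace ℝ (Fin d)

/-- The gradient `∇ L(θ, z)` of the loss with respect to the parameter `θ`. -/
def lossGrad {d : ℕ} {Z : Type*} (loss : Param d → Z → ℝ) (z : Z) (θ : Param d) : Param d :=
  gradient (fun w => loss w z) θ

/-- The Hessian `∇² L(θ, z)` of the loss with respect to the parameter `θ`, as a linear operator;
its norm is the spectral norm. -/
def lossHess {d : ℕ} {Z : Type*} (loss : Param d → Z → ℝ) (z : Z) (θ : Param d) :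
    Param d →L[ℝ] Param d :=
  fderiv ℝ (lossGrad loss z) θ

/-- The loss takes values in `[0, 1]`, is measurable in the example, is `η`-smooth in the parameter
and has a `ρ`-Lipschitz Hessian. -/
structure IsSmoothLoss {d : ℕ} {Z : Type*} [MeasurableSpace Z]
    (loss : Param d → Z → ℝ) (η ρ : ℝ) : Prop where
  mem_Icc : ∀ θ z, loss θ z ∈ Set.Icc (0 : ℝ) 1
  measurable : ∀ θ, Measurable (loss θ)
  differentiable : ∀ z, Differentiable ℝ (fun θ => loss θ z)
  smooth : ∀ z θ θ', ‖lossGrad loss z θ - lossGrad loss z θ'‖ ≤ η * ‖θ - θ'‖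
  differentiable_grad : ∀ z, Differentiable ℝ (lossGrad loss z)
  lipschitz_hess : ∀ z θ θ', ‖lossHess loss z θ - lossHess loss z θ'‖ ≤ ρ * ‖θ - θ'‖

/-- The expected risk `R(θ)` under the data distribution `D`. -/
def risk {d : ℕ} {Z : Type*} [MeasurableSpace Z] (D : Measure Z) (loss : Param d → Z → ℝ)
    (θ : Param d) : ℝ :=
  ∫ z, loss θ z ∂D

/-- The empirical risk `R̂_S(θ)` on the training sample `S`. -/
def empRisk {d : ℕ} {Z : Type*} {n : ℕ} (loss : Param d → Z → ℝ) (S : Fin n → Z)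
    (θ : Param d) : ℝ :=
  (1 / (n : ℝ)) * ∑ j, loss θ (S j)

/-- The output of SGD started at `θ₀` which processes the examples `s 0, …, s (U - 1)` in this
order; the `u`-th step, `u = 1, …, U`, has step size `α u`. -/
def sgd {d : ℕ} {Z : Type*} (loss : Param d → Z → ℝ) (α : ℕ → ℝ) (θ₀ : Param d) :
    (U : ℕ) → (Fin U → Z) → Param d
  | 0, _ => θ₀
  | U + 1, s =>
    let w := sgd loss α θ₀ U (fun i => s i.castSucc)
    w - α (U + 1) • lossGrad loss (s (Fin.last U)) w

/-- All sequences of `n` indices in `{1, …, n}`: sampling the examples with replacement. -/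
def withReplacement (n : ℕ) : Finset (Fin n → Fin n) := Finset.univ

open Classical in
/-- The index sequences which visit every example exactly once: sampling the examples without
replacement. -/
def withoutReplacement (n : ℕ) : Finset (Fin n → Fin n) :=
  Finset.univ.filter Function.Bijective

/-- `E_A[R(A(S)) - R̂_S(A(S))]`: the generalization gap for the training sample `S` of size `n`
of SGD with `n` steps, averaged over an index sequence drawn uniformly from `J`. -/
def sgdGenGap {d : ℕ} {Z : Type*} [MeasurableSpace Z] {n : ℕ} (D : Measure Z)
    (loss : Param d → Z → ℝ) (α : ℕ → ℝ) (θ₀ : Param d) (J : Finset (Fin n → Fin n))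
    (S : Fin n → Z) : ℝ :=
  (1 / (J.card : ℝ)) * ∑ j ∈ J,
    (risk D loss (sgd loss α θ₀ n (fun u => S (j u)))
      - empRisk loss S (sgd loss α θ₀ n (fun u => S (j u))))

/-- SGD on `n` i.i.d. examples from `D`, with `n` steps from `θ₀`, is `ε`-on-average stable: its
expected generalization gap `E_S E_A[R(A(S)) - R̂_S(A(S))]` is at most `ε`. -/
def OnAverageStable {d : ℕ} {Z : Type*} [MeasurableSpace Z] {n : ℕ} (D : Measure Z)
    (loss : Param d → Z → ℝ) (α : ℕ → ℝ) (θ₀ : Param d) (J : Finset (Fin n → Fin n))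
    (ε : ℝ) : Prop :=
  Integrable (sgdGenGap D loss α θ₀ J) (Measure.pi fun _ : Fin n => D) ∧
    ∫ S, sgdGenGap D loss α θ₀ J S ∂(Measure.pi fun _ : Fin n => D) ≤ ε

/-- `γ̂`: the empirical mean of the spectral norms of the Hessians at `θ₀`, plus the square root of
the empirical risk at `θ₀`. -/
def gammaHat {d : ℕ} {Z : Type*} {n : ℕ} (loss : Param d → Z → ℝ) (S : Fin n → Z)
    (θ₀ : Param d) : ℝ :=
  (1 / (n : ℝ)) * ∑ j, ‖lossHess loss (S j) θ₀‖ + √(empRisk loss S θ₀)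

/-- `γ̂⁺ = γ̂ + n^(-1/4)`. -/
def gammaPlus {d : ℕ} {Z : Type*} {n : ℕ} (loss : Param d → Z → ℝ) (S : Fin n → Z)
    (θ₀ : Param d) : ℝ :=
  gammaHat loss S θ₀ + 1 / (n : ℝ) ^ (1 / 4 : ℝ)

/-- `γ̂⁻ = γ̂ - n^(-1/4)`. -/
def gammaMinus {d : ℕ} {Z : Type*} {n : ℕ} (loss : Param d → Z → ℝ) (S : Fin n → Z)
    (θ₀ : Param d) : ℝ :=
  gammaHat loss S θ₀ - 1 / (n : ℝ) ^ (1 / 4 : ℝ)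

/-- `(1 + 1/(c γ̂⁻)) · R̂_S(θ₀)^(cγ̂⁺/(1+cγ̂⁺)) · 1/n^(1/(1+cγ̂⁺))`. -/
def stabilityRate {d : ℕ} {Z : Type*} {n : ℕ} (loss : Param d → Z → ℝ) (c : ℝ) (S : Fin n → Z)
    (θ₀ : Param d) : ℝ :=
  (1 + 1 / (c * gammaMinus loss S θ₀))
    * empRisk loss S θ₀ ^ (c * gammaPlus loss S θ₀ / (1 + c * gammaPlus loss S θ₀))
    * (1 / (n : ℝ) ^ (1 / (1 + c * gammaPlus loss S θ₀)))

end

/-!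
The step size condition `c ≤ 1 / (4 (2 η log n)²)` is so strong that SGD is stable for the simplest of
reasons. By self-bounding, a smooth loss with values in `[0, 1]` has gradients of norm at most
`√(4η)` (`IsSmoothLoss.norm_lossGrad_le`). Two runs which differ in a single training example drift
apart only in the steps which use it, and every other step `u` expands their distance by at most
`1 + η c / u` (`IsSmoothLoss.norm_sgd_sub_sgd_le`). Exchanging the `i`-th example with a fresh one
turns the expected gap into the mean over `i` of such differences, and since each step uses one
example the mean over `i` of the drifts is at most `1 / n` times a sum over all steps
(`IsSmoothLoss.integral_risk_sub_empRisk_le`). This holds for every fixed order of the examples,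
hence for both sampling schemes. As `∑ c / u ≤ 2 c log n ≤ 1 / (8 η²)`, the expected gap is at most
`C / n` with `C = exp (1 / (8η)) / η`.

On the other side, the exponents `cγ̂⁺ / (1 + cγ̂⁺)` and `1 / (1 + cγ̂⁺)` in the rate add up to `1`, and
the first factor is at least `1`. So the rate is at least `1 / n` once `R̂_S(θ₀) ≥ 1 / n`
(`one_div_le_stabilityRate`). If `R(θ₀) > 0`, then for large `n` Chebyshev's inequality gives
`R̂_S(θ₀) ≥ R(θ₀) / 2 > 1 / √n` with probability `1 - δ`, which provides this bound and also
`γ̂⁻ > 0`. If `R(θ₀) = 0`, then `θ₀` almost surely minimizes the loss of every example, SGD never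
moves, and the gap is zero. The Hessians enter the rate, but no bound on them is needed.
-/

/-! ### Self-bounding of smooth nonnegative losses -/

theorem norm_fderiv_sub_toDual_lossGrad {d : ℕ} {Z : Type*} (loss : Param d → Z → ℝ) (z : Z)
    (θ θ' : Param d) :
    ‖fderiv ℝ (fun w => loss w z) θ - InnerProductSpace.toDual ℝ _ (lossGrad loss z θ')‖
      = ‖lossGrad loss z θ - lossGrad loss z θ'‖ := by
  rw [← (InnerProductSpace.toDual ℝ (Param d)).norm_map (lossGrad loss z θ - lossGrad loss z θ'),
    map_sub]
  simp [lossGrad, gradient]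

namespace IsSmoothLoss

variable {d : ℕ} {Z : Type*} [MeasurableSpace Z] {loss : Param d → Z → ℝ} {η ρ : ℝ}

/-- A gradient step of length `1 / (2η)` decreases the loss by at least `‖∇L‖² / (4η)`, and the loss
cannot become negative. -/
theorem norm_lossGrad_sq_le (h : IsSmoothLoss loss η ρ) (hη : 0 < η) (z : Z) (θ : Param d) :
    ‖lossGrad loss z θ‖ ^ 2 ≤ 4 * η * loss θ z := by
  set g := lossGrad loss z θ with hg
  set t : ℝ := 1 / (2 * η) with ht
  have ht0 : 0 < t := by positivity
  have hstep : ‖-(t • g)‖ = t * ‖g‖ := by rw [norm_neg, norm_smul, Real.norm_of_nonneg ht0.le]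
  have key := (convex_closedBall θ (t * ‖g‖)).norm_image_sub_le_of_norm_fderiv_le' (𝕜 := ℝ)
    (f := fun w => loss w z) (φ := InnerProductSpace.toDual ℝ _ g) (C := η * (t * ‖g‖))
    (x := θ) (y := θ - t • g)
    (fun x _ => (h.differentiable z).differentiableAt)
    (fun x hx => by
      rw [hg, norm_fderiv_sub_toDual_lossGrad]
      refine (h.smooth z x θ).trans ?_
      gcongr
      simpa [dist_eq_norm] using hx)
    (Metric.mem_closedBall_self (by positivity))
    (by rw [Metric.mem_closedBall, dist_eq_norm, sub_sub_cancel_left, hstep])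
  rw [sub_sub_cancel_left, hstep, InnerProductSpace.toDual_apply_apply, inner_neg_right,
    inner_smul_right, real_inner_self_eq_norm_sq, Real.norm_eq_abs] at key
  have h0 := (h.mem_Icc (θ - t • g) z).1
  have h1 := (abs_le.1 key).2
  have h2 : η * (t * ‖g‖) * (t * ‖g‖) = t * ‖g‖ ^ 2 / 2 := by
    rw [ht]; field_simp
  have h3 : t * ‖g‖ ^ 2 ≤ 2 * loss θ z := by linarith
  have h4 : ‖g‖ ^ 2 = 2 * η * (t * ‖g‖ ^ 2) := by rw [ht]; field_simp
  rw [h4]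
  nlinarith

theorem norm_lossGrad_le (h : IsSmoothLoss loss η ρ) (hη : 0 < η) (z : Z) (θ : Param d) :
    ‖lossGrad loss z θ‖ ≤ √(4 * η) := by
  refine Real.le_sqrt_of_sq_le ((h.norm_lossGrad_sq_le hη z θ).trans ?_)
  exact mul_le_of_le_one_right (by positivity) (h.mem_Icc θ z).2

theorem lossGrad_eq_zero (h : IsSmoothLoss loss η ρ) (hη : 0 < η) {z : Z} {θ : Param d}
    (h0 : loss θ z = 0) : lossGrad loss z θ = 0 := by
  have := h.norm_lossGrad_sq_le hη z θ
  rw [h0, mul_zero] at this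
  exact norm_eq_zero.1 (pow_eq_zero_iff two_ne_zero |>.1 (le_antisymm this (by positivity)))

theorem abs_loss_sub_le (h : IsSmoothLoss loss η ρ) (hη : 0 < η) (z : Z) (θ θ' : Param d) :
    |loss θ z - loss θ' z| ≤ √(4 * η) * ‖θ - θ'‖ := by
  refine convex_univ.norm_image_sub_le_of_norm_fderiv_le (𝕜 := ℝ) (f := fun w => loss w z)
    (fun x _ => (h.differentiable z).differentiableAt) (fun x _ => ?_) trivial trivial
  rw [← sub_zero (fderiv ℝ _ x)]
  have := h.norm_lossGrad_le hη z x
  rwa [← (InnerProductSpace.toDual ℝ (Param d)).norm_map, lossGrad, gradient,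
    LinearIsometryEquiv.apply_symm_apply, ← sub_zero (fderiv ℝ _ x)] at this

/-! ### Measurability -/

theorem measurable_uncurry_loss (h : IsSmoothLoss loss η ρ) :
    Measurable (Function.uncurry loss) :=
  measurable_uncurry_of_continuous_of_measurable (fun z => (h.differentiable z).continuous)
    h.measurable

/-- Each directional derivative is a limit of difference quotients, which are measurable in the
example. -/
theorem measurable_lossGrad (h : IsSmoothLoss loss η ρ) (θ : Param d) :
    Measurable fun z => lossGrad loss z θ := by
  have hcoord : ∀ v : Param d, Measurable fun z => inner ℝ v (lossGrad loss z θ) := by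
    intro v
    refine measurable_of_tendsto_metrizable (f := fun (k : ℕ) z =>
      (k : ℝ) • (loss (θ + (k : ℝ)⁻¹ • v) z - loss θ z)) (fun k => ?_) ?_
    · exact ((h.measurable _).sub (h.measurable _)).const_smul (k : ℝ)
    · refine tendsto_pi_nhds.2 fun z => ?_
      have hd := ((h.differentiable z).differentiableAt (x := θ)).hasFDerivAt
      have := hd.lim v (c := fun k : ℕ => (k : ℝ)) (l := Filter.atTop)
        (by simpa using tendsto_natCast_atTop_atTop (R := ℝ))
      rwa [real_inner_comm, lossGrad, gradient, InnerProductSpace.toDual_symm_apply]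
  have hsum : (fun z => lossGrad loss z θ) = fun z => ∑ i,
      inner ℝ (EuclideanSpace.basisFun (Fin d) ℝ i) (lossGrad loss z θ) •
        EuclideanSpace.basisFun (Fin d) ℝ i := by
    funext z
    exact ((EuclideanSpace.basisFun (Fin d) ℝ).sum_repr' _).symm
  rw [hsum]
  exact Finset.measurable_fun_sum _ fun i _ => (hcoord _).smul_const _

theorem measurable_uncurry_lossGrad (h : IsSmoothLoss loss η ρ) :
    Measurable (Function.uncurry fun θ z => lossGrad loss z θ) :=
  measurable_uncurry_of_continuous_of_measurable (fun z => (h.differentiable_grad z).continuous)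
    h.measurable_lossGrad

theorem measurable_sgd (h : IsSmoothLoss loss η ρ) (α : ℕ → ℝ) (θ₀ : Param d) (U : ℕ) :
    Measurable (sgd loss α θ₀ U) := by
  induction U with
  | zero => exact measurable_const
  | succ U ih =>
    have hw : Measurable fun s : Fin (U + 1) → Z => sgd loss α θ₀ U fun i => s i.castSucc :=
      ih.comp (measurable_pi_lambda _ fun i => measurable_pi_apply _)
    have hg : Measurable fun s : Fin (U + 1) → Z =>
        lossGrad loss (s (Fin.last U)) (sgd loss α θ₀ U fun i => s i.castSucc) :=
      h.measurable_uncurry_lossGrad.comp (hw.prodMk (measurable_pi_apply (Fin.last U)))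
    exact hw.sub (hg.const_smul (α (U + 1)))

theorem measurable_risk (h : IsSmoothLoss loss η ρ) (D : Measure Z) [IsProbabilityMeasure D] :
    Measurable (risk D loss) :=
  (h.measurable_uncurry_loss.stronglyMeasurable.integral_prod_right (ν := D)).measurable

theorem integrable_loss (h : IsSmoothLoss loss η ρ) (D : Measure Z) [IsProbabilityMeasure D]
    (θ : Param d) : Integrable (loss θ) D :=
  .of_bound (h.measurable θ).aestronglyMeasurable 1 <| .of_forall fun z => by
    rw [Real.norm_of_nonneg (h.mem_Icc θ z).1]; exact (h.mem_Icc θ z).2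

theorem risk_mem_Icc (h : IsSmoothLoss loss η ρ) (D : Measure Z) [IsProbabilityMeasure D]
    (θ : Param d) : risk D loss θ ∈ Set.Icc (0 : ℝ) 1 := by
  refine ⟨integral_nonneg fun z => (h.mem_Icc θ z).1, ?_⟩
  simpa [risk] using integral_mono (h.integrable_loss D θ) (integrable_const (1 : ℝ))
    fun z => (h.mem_Icc θ z).2

end IsSmoothLoss

/-! ### Divergence of two SGD trajectories -/

/-- Two runs of SGD whose examples agree outside the steps in `P` stay close: a step on a common
example expands the distance by a factor `1 + η α ≤ exp (η α)`, and a step on different examples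
adds at most `2 √(4η) α` to it. -/
theorem IsSmoothLoss.norm_sgd_sub_sgd_le {d : ℕ} {Z : Type*} [MeasurableSpace Z]
    {loss : Param d → Z → ℝ} {η ρ : ℝ} (h : IsSmoothLoss loss η ρ) (hη : 0 < η)
    {α : ℕ → ℝ} (hα : ∀ u, 0 ≤ α u) (θ₀ : Param d) (U : ℕ) (P : Fin U → Prop) [DecidablePred P]
    (s s' : Fin U → Z) (hs : ∀ u, ¬ P u → s u = s' u) :
    ‖sgd loss α θ₀ U s - sgd loss α θ₀ U s'‖ ≤
      Real.exp (η * ∑ u : Fin U, α (u + 1)) *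
        (2 * √(4 * η) * ∑ u : Fin U, if P u then α (u + 1) else 0) := by
  induction U with
  | zero => simp [sgd]
  | succ U ih =>
    have ih' := ih (fun i => P i.castSucc) (fun i => s i.castSucc) (fun i => s' i.castSucc)
      fun u hu => hs _ hu
    rw [Fin.sum_univ_castSucc, Fin.sum_univ_castSucc]
    simp only [Fin.val_castSucc, Fin.val_last]
    simp only [sgd]
    set w := sgd loss α θ₀ U fun i => s i.castSucc
    set w' := sgd loss α θ₀ U fun i => s' i.castSucc
    set A := ∑ u : Fin U, α (u + 1) with hA
    set B := ∑ u : Fin U, if P u.castSucc then α (u + 1) else 0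
    set a := α (U + 1)
    set g := √(4 * η)
    have ha : 0 ≤ a := hα _
    have hA0 : 0 ≤ A := Finset.sum_nonneg fun _ _ => hα _
    have hgrad : ‖lossGrad loss (s (Fin.last U)) w - lossGrad loss (s' (Fin.last U)) w'‖ ≤
        η * ‖w - w'‖ + if P (Fin.last U) then 2 * g else 0 := by
      split_ifs with hP
      · refine (norm_sub_le _ _).trans ?_
        have h1 := h.norm_lossGrad_le hη (s (Fin.last U)) w
        have h2 := h.norm_lossGrad_le hη (s' (Fin.last U)) w'
        have : 0 ≤ η * ‖w - w'‖ := by positivity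
        linarith
      · rw [hs _ hP, add_zero]
        exact h.smooth _ _ _
    have hg : 0 ≤ if P (Fin.last U) then 2 * g else 0 := by
      split_ifs <;> positivity
    calc ‖w - a • lossGrad loss (s (Fin.last U)) w
          - (w' - a • lossGrad loss (s' (Fin.last U)) w')‖
        = ‖(w - w') - a • (lossGrad loss (s (Fin.last U)) w
            - lossGrad loss (s' (Fin.last U)) w')‖ := by
          congr 1; module
      _ ≤ ‖w - w'‖ + a * (η * ‖w - w'‖ + if P (Fin.last U) then 2 * g else 0) := by
          refine (norm_sub_le _ _).trans ?_
          rw [norm_smul, Real.norm_of_nonneg ha]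
          gcongr
      _ = (η * a + 1) * ‖w - w'‖ + 1 * (a * if P (Fin.last U) then 2 * g else 0) := by ring
      _ ≤ Real.exp (η * a) * (Real.exp (η * A) * (2 * g * B))
            + Real.exp (η * (A + a)) * (a * if P (Fin.last U) then 2 * g else 0) := by
          gcongr
          · exact Real.add_one_le_exp _
          · exact Real.one_le_exp (by positivity)
      _ = Real.exp (η * (A + a)) * (2 * g * (B + if P (Fin.last U) then a else 0)) := by
          rw [mul_add η, Real.exp_add]
          split_ifs <;> ring

/-! ### Exchanging a training example with a fresh one -/

theorem measurable_update_prod {ι Z : Type*} [DecidableEq ι] [MeasurableSpace Z] (i : ι) :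
    Measurable fun p : (ι → Z) × Z => Function.update p.1 i p.2 := by
  refine measurable_pi_lambda _ fun k => ?_
  rcases eq_or_ne k i with rfl | hk
  · simpa using measurable_snd
  · simpa [hk, Function.comp_def] using (measurable_pi_apply k).comp measurable_fst

/-- Exchanging the `i`-th sample point with an independent fresh one preserves the joint law. -/
theorem measurePreserving_update_prod {ι Z : Type*} [Fintype ι] [DecidableEq ι] [MeasurableSpace Z]
    (D : Measure Z) [IsProbabilityMeasure D] (i : ι) :
    MeasurePreserving (fun p : (ι → Z) × Z => (Function.update p.1 i p.2, p.1 i))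
      ((Measure.pi fun _ => D).prod D) ((Measure.pi fun _ => D).prod D) := by
  have hm : Measurable fun p : (ι → Z) × Z => (Function.update p.1 i p.2, p.1 i) :=
    (measurable_update_prod i).prodMk ((measurable_pi_apply i).comp measurable_fst)
  refine ⟨hm, (Measure.prod_eq_generateFrom generateFrom_pi
    MeasurableSpace.generateFrom_measurableSet isPiSystem_pi
    MeasurableSpace.isPiSystem_measurableSet
    (Measure.FiniteSpanningSetsIn.pi fun _ => D.toFiniteSpanningSetsIn)
    D.toFiniteSpanningSetsIn ?_).symm⟩
  rintro _ ⟨t, ht, rfl⟩ A hA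
  have ht' : ∀ k, MeasurableSet (t k) := fun k => ht k trivial
  have hpre : (fun p : (ι → Z) × Z => (Function.update p.1 i p.2, p.1 i)) ⁻¹'
      (Set.univ.pi t ×ˢ A) = Set.univ.pi (Function.update t i A) ×ˢ t i := by
    ext ⟨S, z⟩
    simp only [Set.mem_preimage, Set.mem_prod, Set.mem_univ_pi]
    constructor
    · rintro ⟨h1, h2⟩
      refine ⟨fun k => ?_, by simpa using h1 i⟩
      rcases eq_or_ne k i with rfl | hk
      · simpa using h2
      · simpa [hk] using h1 k
    · rintro ⟨h1, h2⟩
      refine ⟨fun k => ?_, by simpa using h1 i⟩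
      rcases eq_or_ne k i with rfl | hk
      · simpa using h2
      · simpa [hk] using h1 k
  rw [Measure.map_apply hm ((MeasurableSet.univ_pi ht').prod hA), hpre, Measure.prod_prod,
    Measure.pi_pi, Measure.pi_pi, ← Finset.mul_prod_erase _ _ (Finset.mem_univ i),
    ← Finset.mul_prod_erase _ (fun k => D (t k)) (Finset.mem_univ i), Function.update_self,
    Finset.prod_congr rfl fun k hk => by rw [Function.update_of_ne (Finset.ne_of_mem_erase hk)]]
  ring

/-! ### The expected generalization gap -/

section

variable {d : ℕ} {Z : Type*} [MeasurableSpace Z] {loss : Param d → Z → ℝ} {η ρ : ℝ} {n : ℕ}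

theorem integrable_of_mem_Icc_zero_one {Ω : Type*} [MeasurableSpace Ω] {μ : Measure Ω}
    [IsProbabilityMeasure μ] {f : Ω → ℝ} (hf : Measurable f) (h : ∀ x, f x ∈ Set.Icc (0 : ℝ) 1) :
    Integrable f μ :=
  .of_bound hf.aestronglyMeasurable 1 <| .of_forall fun x => by
    rw [Real.norm_of_nonneg (h x).1]; exact (h x).2

/-- Training on `S` with its `i`-th point replaced turns that point into a fresh one, so the gap
between the risk and the loss at `S i` is a mean difference of the losses of two trajectories that
only differ in the steps which use example `i`. -/
theorem IsSmoothLoss.integral_risk_sub_integral_loss_le (h : IsSmoothLoss loss η ρ) (hη : 0 < η)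
    {α : ℕ → ℝ} (hα : ∀ u, 0 ≤ α u) (D : Measure Z) [IsProbabilityMeasure D] (θ₀ : Param d)
    (j : Fin n → Fin n) (i : Fin n) :
    (∫ S, risk D loss (sgd loss α θ₀ n fun u => S (j u)) ∂(Measure.pi fun _ : Fin n => D))
      - ∫ S, loss (sgd loss α θ₀ n fun u => S (j u)) (S i) ∂(Measure.pi fun _ : Fin n => D) ≤
    8 * η * Real.exp (η * ∑ u : Fin n, α (u + 1)) *
      ∑ u : Fin n, if j u = i then α (u + 1) else 0 := by
  set A : (Fin n → Z) → Param d := fun S => sgd loss α θ₀ n fun u => S (j u) with hA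
  set μ := Measure.pi fun _ : Fin n => D
  set K := Real.exp (η * ∑ u : Fin n, α (u + 1))
  set B := ∑ u : Fin n, if j u = i then α (u + 1) else 0
  have hAm : Measurable A := (h.measurable_sgd α θ₀ n).comp
    (measurable_pi_lambda _ fun _ => measurable_pi_apply _)
  have hup := measurable_update_prod (Z := Z) i
  have hev : Measurable fun p : (Fin n → Z) × Z => p.1 i :=
    (measurable_pi_apply i).comp measurable_fst
  have hm1 : Measurable fun p : (Fin n → Z) × Z => loss (A p.1) p.2 :=
    h.measurable_uncurry_loss.comp ((hAm.comp measurable_fst).prodMk measurable_snd)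
  have hm2 : Measurable fun p : (Fin n → Z) × Z =>
      loss (A (Function.update p.1 i p.2)) (p.1 i) :=
    h.measurable_uncurry_loss.comp ((hAm.comp hup).prodMk hev)
  have hm3 : Measurable fun p : (Fin n → Z) × Z => loss (A p.1) (p.1 i) :=
    h.measurable_uncurry_loss.comp ((hAm.comp measurable_fst).prodMk hev)
  have e1 : ∫ S, risk D loss (A S) ∂μ = ∫ p, loss (A p.1) p.2 ∂(μ.prod D) :=
    (integral_prod (fun p : (Fin n → Z) × Z => loss (A p.1) p.2)
      (integrable_of_mem_Icc_zero_one hm1 fun p => h.mem_Icc _ _)).symm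
  have e2 : ∫ p, loss (A p.1) p.2 ∂(μ.prod D)
      = ∫ p, loss (A (Function.update p.1 i p.2)) (p.1 i) ∂(μ.prod D) := by
    have hmp := measurePreserving_update_prod D i
    conv_lhs => rw [← hmp.map_eq]
    exact integral_map hmp.measurable.aemeasurable hm1.aestronglyMeasurable
  have e3 : ∫ S, loss (A S) (S i) ∂μ = ∫ p, loss (A p.1) (p.1 i) ∂(μ.prod D) := by
    rw [integral_prod _ (integrable_of_mem_Icc_zero_one hm3 fun p => h.mem_Icc _ _)]
    simp
  have hi2 := integrable_of_mem_Icc_zero_one (μ := μ.prod D) hm2 fun p => h.mem_Icc _ _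
  have hi3 := integrable_of_mem_Icc_zero_one (μ := μ.prod D) hm3 fun p => h.mem_Icc _ _
  rw [e1, e2, e3, ← integral_sub hi2 hi3]
  have hle : ∀ p : (Fin n → Z) × Z,
      loss (A (Function.update p.1 i p.2)) (p.1 i) - loss (A p.1) (p.1 i) ≤ 8 * η * K * B := by
    intro p
    have hdist := h.norm_sgd_sub_sgd_le hη hα θ₀ n (fun u => j u = i)
      (fun u => Function.update p.1 i p.2 (j u)) (fun u => p.1 (j u))
      fun u hu => Function.update_of_ne hu _ _
    calc _ ≤ √(4 * η) * ‖A (Function.update p.1 i p.2) - A p.1‖ :=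
          (le_abs_self _).trans (h.abs_loss_sub_le hη _ _ _)
      _ ≤ √(4 * η) * (K * (2 * √(4 * η) * B)) := by gcongr
      _ = 2 * (√(4 * η) * √(4 * η)) * K * B := by ring
      _ = 8 * η * K * B := by rw [Real.mul_self_sqrt (by positivity)]; ring
  simpa using integral_mono (hi2.sub hi3) (integrable_const (8 * η * K * B)) hle

theorem IsSmoothLoss.empRisk_mem_Icc (h : IsSmoothLoss loss η ρ) (S : Fin n → Z) (θ : Param d) :
    empRisk loss S θ ∈ Set.Icc (0 : ℝ) 1 := by
  have hsum : ∑ j, loss θ (S j) ≤ n := by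
    simpa using Finset.sum_le_card_nsmul Finset.univ _ 1 fun j _ => (h.mem_Icc θ (S j)).2
  refine ⟨mul_nonneg (by positivity) (Finset.sum_nonneg fun j _ => (h.mem_Icc θ (S j)).1), ?_⟩
  rw [empRisk, one_div_mul_eq_div]
  exact div_le_one_of_le₀ hsum n.cast_nonneg

theorem IsSmoothLoss.measurable_empRisk_sgd (h : IsSmoothLoss loss η ρ) (α : ℕ → ℝ)
    (θ₀ : Param d) (j : Fin n → Fin n) :
    Measurable fun S : Fin n → Z => empRisk loss S (sgd loss α θ₀ n fun u => S (j u)) := by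
  have hA : Measurable fun S : Fin n → Z => sgd loss α θ₀ n fun u => S (j u) :=
    (h.measurable_sgd α θ₀ n).comp (measurable_pi_lambda _ fun _ => measurable_pi_apply _)
  exact (Finset.measurable_fun_sum _ fun i _ =>
    h.measurable_uncurry_loss.comp (hA.prodMk (measurable_pi_apply i))).const_mul _

theorem IsSmoothLoss.integrable_risk_sgd (h : IsSmoothLoss loss η ρ) (α : ℕ → ℝ) (D : Measure Z)
    [IsProbabilityMeasure D] (θ₀ : Param d) (j : Fin n → Fin n) :
    Integrable (fun S => risk D loss (sgd loss α θ₀ n fun u => S (j u)))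
      (Measure.pi fun _ : Fin n => D) :=
  integrable_of_mem_Icc_zero_one ((h.measurable_risk D).comp ((h.measurable_sgd α θ₀ n).comp
    (measurable_pi_lambda _ fun _ => measurable_pi_apply _))) fun _ => h.risk_mem_Icc D _

theorem IsSmoothLoss.integrable_empRisk_sgd (h : IsSmoothLoss loss η ρ) (α : ℕ → ℝ) (D : Measure Z)
    [IsProbabilityMeasure D] (θ₀ : Param d) (j : Fin n → Fin n) :
    Integrable (fun S => empRisk loss S (sgd loss α θ₀ n fun u => S (j u)))
      (Measure.pi fun _ : Fin n => D) :=
  integrable_of_mem_Icc_zero_one (h.measurable_empRisk_sgd α θ₀ j) fun _ => h.empRisk_mem_Icc _ _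

/-- For each fixed order of the examples the expected gap is an average over the replaced example
`i`. Each step uses exactly one example, so summing over `i` counts every step size once, whether
or not examples are repeated. -/
theorem IsSmoothLoss.integral_risk_sub_empRisk_le (h : IsSmoothLoss loss η ρ) (hη : 0 < η)
    {α : ℕ → ℝ} (hα : ∀ u, 0 ≤ α u) (D : Measure Z) [IsProbabilityMeasure D] (θ₀ : Param d)
    (hn : n ≠ 0) (j : Fin n → Fin n) :
    ∫ S, (risk D loss (sgd loss α θ₀ n fun u => S (j u))
      - empRisk loss S (sgd loss α θ₀ n fun u => S (j u))) ∂(Measure.pi fun _ : Fin n => D) ≤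
    1 / n * (8 * η * Real.exp (η * ∑ u : Fin n, α (u + 1)) * ∑ u : Fin n, α (u + 1)) := by
  have hn' : (n : ℝ) ≠ 0 := Nat.cast_ne_zero.2 hn
  have hA : Measurable fun S : Fin n → Z => sgd loss α θ₀ n fun u => S (j u) :=
    (h.measurable_sgd α θ₀ n).comp (measurable_pi_lambda _ fun _ => measurable_pi_apply _)
  have hint : ∀ i, Integrable (fun S : Fin n → Z => loss (sgd loss α θ₀ n fun u => S (j u)) (S i))
      (Measure.pi fun _ : Fin n => D) := fun i => integrable_of_mem_Icc_zero_one
    (h.measurable_uncurry_loss.comp (hA.prodMk (measurable_pi_apply i))) fun _ => h.mem_Icc _ _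
  have hswap : ∑ i, ∑ u : Fin n, (if j u = i then α (u + 1) else 0) = ∑ u : Fin n, α (u + 1) := by
    rw [Finset.sum_comm]
    simp
  rw [integral_sub (h.integrable_risk_sgd α D θ₀ j) (h.integrable_empRisk_sgd α D θ₀ j)]
  simp only [empRisk]
  rw [integral_const_mul, integral_finsetSum _ fun i _ => hint i]
  set r := ∫ S, risk D loss (sgd loss α θ₀ n fun u => S (j u)) ∂(Measure.pi fun _ : Fin n => D)
  have hr : r = 1 / n * ∑ _i : Fin n, r := by simp [field]
  conv_lhs => rw [hr, ← mul_sub, ← Finset.sum_sub_distrib]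
  refine mul_le_mul_of_nonneg_left ?_ (by positivity)
  -- This also rewrites the sum in the exponent, hence the `hswap ▸` below.
  rw [← hswap, Finset.mul_sum]
  exact Finset.sum_le_sum fun i _ => hswap ▸ h.integral_risk_sub_integral_loss_le hη hα D θ₀ j i

theorem OnAverageStable.of_forall_integral_le (h : IsSmoothLoss loss η ρ) (D : Measure Z)
    [IsProbabilityMeasure D] {α : ℕ → ℝ} {θ₀ : Param d} {ε : ℝ} (hε : 0 ≤ ε)
    (J : Finset (Fin n → Fin n))
    (hJ : ∀ j ∈ J, ∫ S, (risk D loss (sgd loss α θ₀ n fun u => S (j u))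
      - empRisk loss S (sgd loss α θ₀ n fun u => S (j u))) ∂(Measure.pi fun _ : Fin n => D) ≤ ε) :
    OnAverageStable D loss α θ₀ J ε := by
  have hint : ∀ j : Fin n → Fin n, Integrable (fun S =>
      risk D loss (sgd loss α θ₀ n fun u => S (j u))
        - empRisk loss S (sgd loss α θ₀ n fun u => S (j u))) (Measure.pi fun _ : Fin n => D) :=
    fun j => (h.integrable_risk_sgd α D θ₀ j).sub (h.integrable_empRisk_sgd α D θ₀ j)
  refine ⟨(integrable_finsetSum J fun j _ => hint j).const_mul _, ?_⟩
  simp only [sgdGenGap]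
  rw [integral_const_mul, integral_finsetSum J fun j _ => hint j, one_div_mul_eq_div]
  refine div_le_of_le_mul₀ (Nat.cast_nonneg _) hε ?_
  rw [mul_comm, ← nsmul_eq_mul]
  exact Finset.sum_le_card_nsmul _ _ _ hJ

theorem IsSmoothLoss.sgd_eq_init_of_loss_eq_zero (h : IsSmoothLoss loss η ρ) (hη : 0 < η) (α : ℕ → ℝ)
    (θ₀ : Param d) (U : ℕ) (s : Fin U → Z) (hs : ∀ u, loss θ₀ (s u) = 0) :
    sgd loss α θ₀ U s = θ₀ := by
  induction U with
  | zero => rfl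
  | succ U ih =>
    simp only [sgd, ih (fun i => s i.castSucc) fun u => hs _, h.lossGrad_eq_zero hη (hs _),
      smul_zero, sub_zero]

/-- If the initialization has zero risk, then it is almost surely a minimum of every loss of the
sample, SGD does not move, and there is no generalization gap. -/
theorem IsSmoothLoss.integral_risk_sub_empRisk_eq_zero (h : IsSmoothLoss loss η ρ) (hη : 0 < η)
    (α : ℕ → ℝ) (D : Measure Z) [IsProbabilityMeasure D] (θ₀ : Param d)
    (h0 : risk D loss θ₀ = 0) (j : Fin n → Fin n) :
    ∫ S, (risk D loss (sgd loss α θ₀ n fun u => S (j u))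
      - empRisk loss S (sgd loss α θ₀ n fun u => S (j u))) ∂(Measure.pi fun _ : Fin n => D)
      = 0 := by
  have hae : ∀ᵐ z ∂D, loss θ₀ z = 0 :=
    (integral_eq_zero_iff_of_nonneg (fun z => (h.mem_Icc θ₀ z).1) (h.integrable_loss D θ₀)).1 h0
  have hall : ∀ᵐ S ∂(Measure.pi fun _ : Fin n => D), ∀ i, loss θ₀ (S i) = 0 :=
    ae_all_iff.2 fun i => (measurePreserving_eval (fun _ : Fin n => D) i).quasiMeasurePreserving.ae
      hae
  refine integral_eq_zero_of_ae ?_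
  filter_upwards [hall] with S hS
  rw [h.sgd_eq_init_of_loss_eq_zero hη α θ₀ n _ fun u => hS (j u), h0]
  simp [empRisk, hS]

/-! ### Concentration of the empirical risk -/

/-- Chebyshev's inequality for the empirical risk at a fixed parameter. -/
theorem IsSmoothLoss.measure_empRisk_lt_half_le (h : IsSmoothLoss loss η ρ) (D : Measure Z)
    [IsProbabilityMeasure D] (θ : Param d) (hn : n ≠ 0) (hr : 0 < risk D loss θ) :
    (Measure.pi fun _ : Fin n => D) {S | empRisk loss S θ < risk D loss θ / 2} ≤
      ENNReal.ofReal (1 / (n * risk D loss θ ^ 2)) := by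
  set r := risk D loss θ
  have hn' : (0 : ℝ) < n := by positivity
  set X : (Fin n → Z) → ℝ := ∑ i, fun S => loss θ (S i) with hX
  have hmem : MemLp (loss θ) 2 D := .of_bound (h.measurable θ).aestronglyMeasurable 1 <|
    .of_forall fun z => by rw [Real.norm_of_nonneg (h.mem_Icc θ z).1]; exact (h.mem_Icc θ z).2
  have hmemi : ∀ i, MemLp (fun S : Fin n → Z => loss θ (S i)) 2 (Measure.pi fun _ => D) :=
    fun i => hmem.comp_measurePreserving (measurePreserving_eval (fun _ : Fin n => D) i)
  have hXmem : MemLp X 2 (Measure.pi fun _ : Fin n => D) := memLp_finsetSum' _ fun i _ => hmemi i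
  have hvar : ProbabilityTheory.variance X (Measure.pi fun _ : Fin n => D) ≤ n / 4 := by
    rw [hX, ProbabilityTheory.variance_sum_pi (X := fun _ : Fin n => loss θ) fun _ => hmem]
    have h1 := ProbabilityTheory.variance_le_sq_of_bounded (μ := D)
      (.of_forall (h.mem_Icc θ)) (h.measurable θ).aemeasurable
    rw [Finset.sum_const, Finset.card_univ, Fintype.card_fin, nsmul_eq_mul]
    nlinarith
  have hmean : ∫ S, X S ∂(Measure.pi fun _ : Fin n => D) = n * r := by
    simp only [hX, Finset.sum_apply]
    rw [integral_finsetSum _ fun i _ => (hmemi i).integrable one_le_two]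
    have : ∀ i : Fin n, ∫ S : Fin n → Z, loss θ (S i) ∂(Measure.pi fun _ => D) = r := fun i =>
      integral_comp_eval (μ := fun _ : Fin n => D) (h.measurable θ).aestronglyMeasurable
    simp [this]
  have hsub : {S : Fin n → Z | empRisk loss S θ < r / 2} ⊆
      {S | n * r / 2 ≤ |X S - ∫ S, X S ∂(Measure.pi fun _ : Fin n => D)|} := by
    intro S hS
    simp only [Set.mem_ofPred_eq, empRisk, one_div_mul_eq_div, div_lt_iff₀ hn'] at hS
    rw [Set.mem_ofPred_eq, hmean, abs_sub_comm, hX, Finset.sum_apply]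
    exact le_trans (by linarith) (le_abs_self _)
  refine (measure_mono hsub).trans <| (ProbabilityTheory.meas_ge_le_variance_div_sq hXmem
    (by positivity)).trans <| ENNReal.ofReal_le_ofReal ?_
  rw [div_le_div_iff₀ (by positivity) (by positivity)]
  calc _ ≤ (n : ℝ) / 4 * (n * r ^ 2) := by gcongr
    _ = 1 * (n * r / 2) ^ 2 := by ring

/-! ### Comparison with the rate -/

theorem one_le_log_of_three_le {n : ℕ} (hn : 3 ≤ n) : 1 ≤ Real.log n := by
  rw [Real.le_log_iff_exp_le (by positivity)]
  have : (3 : ℝ) ≤ n := by exact_mod_cast hn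
  linarith [Real.exp_one_lt_three]

theorem sum_div_succ_le {n : ℕ} (c : ℝ) (hc : 0 ≤ c) (hn : 3 ≤ n) :
    ∑ u : Fin n, c / ((u + 1 : ℕ) : ℝ) ≤ 2 * c * Real.log n := by
  have hlog := one_le_log_of_three_le hn
  have hH := harmonic_le_one_add_log n
  rw [Fin.sum_univ_eq_sum_range (fun u : ℕ => c / ((u + 1 : ℕ) : ℝ))]
  have : ∑ u ∈ Finset.range n, c / ((u + 1 : ℕ) : ℝ) = c * (harmonic n : ℝ) := by
    simp [harmonic, Finset.mul_sum, div_eq_mul_inv]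
  rw [this]
  nlinarith

theorem stabilityRate_nonneg (h : IsSmoothLoss loss η ρ) {c : ℝ} (hc : 0 < c) {S : Fin n → Z}
    {θ₀ : Param d} (hγ : 0 < gammaMinus loss S θ₀) : 0 ≤ stabilityRate loss c S θ₀ := by
  have := (h.empRisk_mem_Icc S θ₀).1
  unfold stabilityRate
  positivity

end

section

variable {d : ℕ} {Z : Type*} {loss : Param d → Z → ℝ} {n : ℕ}

/-- The two powers in the rate have exponents with sum `1`, so that their product is at least `1 / n`
as soon as the empirical risk at the initialization is. -/
theorem one_div_le_stabilityRate {c : ℝ} (hc : 0 < c) {S : Fin n → Z} {θ₀ : Param d} (hn : n ≠ 0)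
    (hemp : 1 / (n : ℝ) ≤ empRisk loss S θ₀) (hγ : 0 < gammaMinus loss S θ₀) :
    1 / (n : ℝ) ≤ stabilityRate loss c S θ₀ := by
  have hn' : (0 : ℝ) < n := by positivity
  have hγ' : 0 < gammaPlus loss S θ₀ := by
    have : 0 ≤ 1 / (n : ℝ) ^ (1 / 4 : ℝ) := by positivity
    unfold gammaMinus at hγ
    unfold gammaPlus
    linarith
  unfold stabilityRate
  set a := c * gammaPlus loss S θ₀ with ha
  have ha0 : 0 < a := by positivity
  have hexp : a / (1 + a) + 1 / (1 + a) = 1 := by field_simp; ring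
  calc 1 / (n : ℝ) = 1 * (1 / (n : ℝ)) ^ (a / (1 + a)) * (1 / (n : ℝ) ^ (1 / (1 + a))) := by
        rw [one_mul, Real.div_rpow zero_le_one hn'.le, Real.one_rpow, one_div_mul_one_div,
          ← Real.rpow_add hn', hexp, Real.rpow_one]
    _ ≤ _ := by
        gcongr
        exact le_add_of_nonneg_right (by positivity)

theorem gammaMinus_pos (S : Fin n → Z) (θ₀ : Param d) (hn : n ≠ 0)
    (h : 1 / √(n : ℝ) < empRisk loss S θ₀) : 0 < gammaMinus loss S θ₀ := by
  have hn' : (0 : ℝ) < n := by positivity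
  have hroot : 1 / (n : ℝ) ^ (1 / 4 : ℝ) = √(1 / √(n : ℝ)) := by
    rw [Real.sqrt_div zero_le_one, Real.sqrt_one, Real.sqrt_eq_rpow, Real.sqrt_eq_rpow,
      ← Real.rpow_mul hn'.le]
    norm_num
  have hlt : √(1 / √(n : ℝ)) < √(empRisk loss S θ₀) := Real.sqrt_lt_sqrt (by positivity) h
  have : 0 ≤ 1 / (n : ℝ) * ∑ j, ‖lossHess loss (S j) θ₀‖ := by positivity
  unfold gammaMinus gammaHat
  linarith

end

/-- Under the step size condition the sum of the steps is at most `1 / (8 η²)`, uniformly in `n`, so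
that the expected gap is `O(1/n)`, with a constant that depends on `η` only. -/
theorem IsSmoothLoss.integral_risk_sub_empRisk_le_div {d : ℕ} {Z : Type*} [MeasurableSpace Z]
    {loss : Param d → Z → ℝ} {η ρ c : ℝ} {n : ℕ} (h : IsSmoothLoss loss η ρ) (hη : 0 < η)
    (D : Measure Z) [IsProbabilityMeasure D] (θ₀ : Param d) (hn : 3 ≤ n) (hc : 0 < c)
    (hcn : c ≤ 1 / (4 * (2 * η * Real.log n) ^ 2)) (j : Fin n → Fin n) :
    ∫ S, (risk D loss (sgd loss (fun u => c / u) θ₀ n fun u => S (j u))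
      - empRisk loss S (sgd loss (fun u => c / u) θ₀ n fun u => S (j u)))
        ∂(Measure.pi fun _ : Fin n => D) ≤
    Real.exp (1 / (8 * η)) / η * (1 / n) := by
  have hlog := one_le_log_of_three_le hn
  have hsum : ∑ u : Fin n, c / ((u + 1 : ℕ) : ℝ) ≤ 1 / (8 * η ^ 2) := by
    refine (sum_div_succ_le c hc.le hn).trans ?_
    calc 2 * c * Real.log n
        ≤ 2 * (1 / (4 * (2 * η * Real.log n) ^ 2)) * Real.log n := by gcongr
      _ = 1 / (8 * η ^ 2 * Real.log n) := by field_simp; norm_num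
      _ ≤ 1 / (8 * η ^ 2) := by
          exact one_div_le_one_div_of_le (by positivity)
            (le_mul_of_one_le_right (by positivity) hlog)
  refine (h.integral_risk_sub_empRisk_le hη (fun u => by positivity) D θ₀ (by lia) j).trans ?_
  rw [mul_comm]
  gcongr
  calc _ ≤ 8 * η * Real.exp (η * (1 / (8 * η ^ 2))) * (1 / (8 * η ^ 2)) := by
        gcongr
    _ = Real.exp (1 / (8 * η)) / η := by
        rw [show η * (1 / (8 * η ^ 2)) = 1 / (8 * η) by field_simp]
        field_simp

theorem theorem2 :
    ∃ N : ℝ → ℝ → ℕ, ∀ η ρ : ℝ, 0 < η → 0 ≤ ρ → ∃ C : ℝ, 0 < C ∧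
      ∀ (δ : ℝ), 0 < δ → δ < 1 →
      ∀ (d : ℕ) (Z : Type*) [MeasurableSpace Z] (D : MeasureTheory.Measure Z)
        [MeasureTheory.IsProbabilityMeasure D] (loss : Param d → Z → ℝ) (θ₀ : Param d),
        IsSmoothLoss loss η ρ →
        ∀ n : ℕ, N δ (risk D loss θ₀) ≤ n →
          MeasureTheory.Measure.pi (fun _ : Fin n => D)
            {S : Fin n → Z | ¬ ((0 < risk D loss θ₀ → 0 < gammaMinus loss S θ₀) ∧
              (0 < gammaMinus loss S θ₀ →
                ∀ c : ℝ, 0 < c → c ≤ min (1 / η) (1 / (4 * (2 * η * Real.log n) ^ 2)) →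
                ∀ J : Finset (Fin n → Fin n), J = withReplacement n ∨ J = withoutReplacement n →
                  OnAverageStable D loss (fun u => c / u) θ₀ J
                    (C * stabilityRate loss c S θ₀)))}
            ≤ ENNReal.ofReal δ := by
  -- `n > 4 / (δ r²)` serves Chebyshev's bound `1 / (n r²) ≤ δ` and, as `δ < 1`, also `1 / √n < r / 2`.
  refine ⟨fun δ r => max 3 (⌊4 / (δ * r ^ 2)⌋₊ + 1), fun η ρ hη _ =>
    ⟨Real.exp (1 / (8 * η)) / η, by positivity, ?_⟩⟩
  intro δ hδ hδ1 d Z _ D _ loss θ₀ h n hN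
  have hn3 : 3 ≤ n := (le_max_left _ _).trans hN
  have hn0 : n ≠ 0 := by lia
  have hn' : (0 : ℝ) < n := by positivity
  rcases (h.risk_mem_Icc D θ₀).1.eq_or_lt with hr | hr
  · refine (measure_mono_null (t := ∅) (fun S hS => ?_) measure_empty).trans_le zero_le
    refine absurd ?_ hS
    refine ⟨fun hr' => absurd hr hr'.ne, fun hγ c hc _ J _ => ?_⟩
    have hε : 0 ≤ Real.exp (1 / (8 * η)) / η * stabilityRate loss c S θ₀ :=
      mul_nonneg (by positivity) (stabilityRate_nonneg h hc hγ)
    exact .of_forall_integral_le h D hε J fun j _ =>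
      (h.integral_risk_sub_empRisk_eq_zero hη _ D θ₀ hr.symm j).trans_le hε
  · set r := risk D loss θ₀
    have hnr : 4 < n * (δ * r ^ 2) := by
      have h1 : ⌊4 / (δ * r ^ 2)⌋₊ < n := (le_max_right _ _).trans hN
      exact (div_lt_iff₀ (by positivity)).1 ((Nat.floor_lt (by positivity)).1 h1)
    have hsqrt : 1 / √(n : ℝ) < r / 2 := by
      rw [div_lt_div_iff₀ (by positivity) two_pos, one_mul]
      refine lt_of_pow_lt_pow_left₀ 2 (by positivity) ?_
      rw [mul_pow, Real.sq_sqrt hn'.le]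
      nlinarith [mul_pos hn' (pow_pos hr 2)]
    have hsqrt_le : 1 / (n : ℝ) ≤ 1 / √(n : ℝ) := by
      gcongr
      exact Real.sqrt_le_left (by positivity) |>.2 (by
        have : (1 : ℝ) ≤ n := by exact_mod_cast Nat.one_le_iff_ne_zero.2 hn0
        nlinarith)
    refine (measure_mono ?_).trans ((h.measure_empRisk_lt_half_le D θ₀ hn0 hr).trans
      (ENNReal.ofReal_le_ofReal ?_))
    · intro S hS
      by_contra hgood
      have hemp : r / 2 ≤ empRisk loss S θ₀ := not_lt.1 hgood
      refine hS ⟨fun _ => gammaMinus_pos S θ₀ hn0 (hsqrt.trans_le hemp),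
        fun hγ c hc hcn J _ => ?_⟩
      have hrate := one_div_le_stabilityRate hc hn0 (by linarith) hγ
      refine .of_forall_integral_le h D (mul_nonneg (by positivity)
        (stabilityRate_nonneg h hc hγ)) J fun j _ =>
        (h.integral_risk_sub_empRisk_le_div hη D θ₀ hn3 hc (hcn.trans (min_le_right _ _)) j).trans ?_
      gcongr
    · rw [div_le_iff₀ (by positivity)]
      linarith
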